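/- Let $X$ be a Tychonoff space (i.e. completely regular and Hausdorff), let $C(X)$ be the set of continuous functions $X\to\mathbb R$, and let $C_w(X)$ be $C(X)$ with the fine topology (also called the $m$-topology), i.e. the topology having as a base the sets $$B(f,\varepsilon)=\{g\in C(X): |f(x)-g(x)|<\varepsilon(x)\ \text{for all } x\in X\},$$ where $f\in C(X)$ and $\varepsilon:X\to(0,\infty)$ is continuous. The following are equivalent: 1. $C_w(X)$ is completely metrizable; 2. $C_w(X)$ is Čech complete, i.e. a $G_\delta$-subspace of one of its (Hausdorff) compactifications; 3. $C_w(X)$ is sieve complete, i.e. the image of a Čech complete space under a continuous open map; 4. $C_w(X)$ is hereditarily Baire, i.e. every nonempty closed subspace of $C_w(X)$ is a Baire space; 5. $X$ is pseudocompact, i.e. every continuous real-valued function on $X$ is bounded. -/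

import Mathlib

/-- The set `B(f, ε)` of all continuous `g : X → Y` with `d (f x, g x) < ε x` for all `x`. -/
def fineBall {X Y : Type*} [TopologicalSpace X] [MetricSpace Y]
    (f : C(X, Y)) (ε : C(X, ℝ)) : Set C(X, Y) :=
  {g | ∀ x, dist (f x) (g x) < ε x}

/-- The fine topology (`m`-topology) on the set of continuous functions `X → Y`: it is generated
by the sets `B(f, ε)` with `f` continuous and `ε : X → ℝ` continuous and strictly positive. -/
abbrev fineTopology (X Y : Type*) [TopologicalSpace X] [MetricSpace Y] :
    TopologicalSpace C(X, Y) :=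
  TopologicalSpace.generateFrom
    {B | ∃ (f : C(X, Y)) (ε : C(X, ℝ)), (∀ x, 0 < ε x) ∧ B = fineBall f ε}

/-- The space `C_w(X, Y)`: a type synonym of `C(X, Y)` (whose own topology in Mathlib is the
compact-open one), equipped with the fine topology. -/
def FineC (X Y : Type*) [TopologicalSpace X] [MetricSpace Y] : Type _ := C(X, Y)

instance (X Y : Type*) [TopologicalSpace X] [MetricSpace Y] : TopologicalSpace (FineC X Y) :=
  fineTopology X Y

/-- `Z` is Čech complete: it is (homeomorphic to) a dense `Gδ` subspace of a compact Hausdorff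
space, i.e. a `Gδ` subspace of one of its compactifications. Every compactification of `Z` is a
quotient of `StoneCech Z`, so the universe of `Z` is large enough. -/
def IsCechComplete.{u} (Z : Type u) [TopologicalSpace Z] : Prop :=
  ∃ (K : Type u) (_ : TopologicalSpace K) (_ : CompactSpace K) (_ : T2Space K) (e : Z → K),
    Topology.IsEmbedding e ∧ DenseRange e ∧ IsGδ (Set.range e)

/-- `Z` is sieve complete: it is the image of a Čech complete space under a continuous open
map. -/
def IsSieveComplete.{u} (Z : Type u) [TopologicalSpace Z] : Prop :=
  ∃ (W : Type u) (_ : TopologicalSpace W) (p : W → Z),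
    IsCechComplete W ∧ Continuous p ∧ IsOpenMap p ∧ Function.Surjective p

/-- `Z` is hereditarily Baire: every closed subspace of `Z` is a Baire space. -/
def IsHereditarilyBaire (Z : Type*) [TopologicalSpace Z] : Prop :=
  ∀ F : Set Z, IsClosed F → BaireSpace F

/-- `X` is pseudocompact: every continuous real-valued function on `X` is bounded. -/
def IsPseudocompact (X : Type*) [TopologicalSpace X] : Prop :=
  ∀ f : C(X, ℝ), ∃ M : ℝ, ∀ x, |f x| ≤ M

/-! The equivalences follow from one cycle of implications.

A completely metrizable space is a `Gδ` set in its Stone–Čech compactification. A closed subspace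
of a Čech complete space is a `Gδ` set in a compact Hausdorff space and hence Baire, and this
passes to images under continuous open maps, so sieve complete spaces are hereditarily Baire.

If `X` is not pseudocompact, an unbounded function and Tietze's theorem on `ℝ` give a sequence
`x n` in `X` on which continuous functions take arbitrary values (`exists_interpolating_seq`). Near
this sequence the fine topology behaves like the box topology on `ℝ^ℕ`, where the finitely
supported sequences form a closed subspace that is a countable union of the nowhere dense closed
sets `ℝ^n`. The corresponding subspace of `C_w(X)`, consisting of the functions that vanish at
almost all `x n`, is closed and not Baire (`IsHereditarilyBaire.isPseudocompact`).

If `X` is pseudocompact, every positive continuous function on `X` is bounded away from zero, so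
the fine topology is that of uniform convergence, and `C_w(X)` is homeomorphic to the complete
metric space of bounded continuous functions. -/

open Set Filter Topology TopologicalSpace

/-! ### Neighbourhoods in the fine topology -/

section FineTopology

variable {X Y : Type*} [TopologicalSpace X] [MetricSpace Y]

theorem exists_fineBall_subset_fineBall {f g : C(X, Y)} {ε : C(X, ℝ)} (h : g ∈ fineBall f ε) :
    ∃ δ : C(X, ℝ), (∀ x, 0 < δ x) ∧ fineBall g δ ⊆ fineBall f ε := by
  refine ⟨⟨fun x => ε x - dist (f x) (g x), by fun_prop⟩, fun x => sub_pos.2 (h x),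
    fun k hk x => ?_⟩
  have h₁ : dist (g x) (k x) < ε x - dist (f x) (g x) := hk x
  have h₂ := dist_triangle (f x) (g x) (k x)
  change dist (f x) (k x) < ε x
  linarith

/-- The sets `fineBall f ε` generate the fine topology; in fact those centred at `f` already form
a neighbourhood basis at `f`. -/
theorem FineC.nhds_hasBasis (f : FineC X Y) :
    (𝓝 f).HasBasis (fun ε : C(X, ℝ) => ∀ x, 0 < ε x) (fun ε => fineBall (X := X) (Y := Y) f ε) := by
  have key : ∀ U : Set (FineC X Y), IsOpen U → ∀ g ∈ U,
      ∃ ε : C(X, ℝ), (∀ x, 0 < ε x) ∧ fineBall (X := X) (Y := Y) g ε ⊆ U := by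
    intro U hU
    induction hU with
    | basic s hs =>
      obtain ⟨k, ε, -, rfl⟩ := hs
      exact fun g hg => exists_fineBall_subset_fineBall hg
    | univ => exact fun g _ => ⟨1, fun _ => one_pos, subset_univ _⟩
    | inter s t _ _ ihs iht =>
      rintro g ⟨hgs, hgt⟩
      obtain ⟨ε, hε, hs⟩ := ihs g hgs
      obtain ⟨δ, hδ, ht⟩ := iht g hgt
      exact ⟨ε ⊓ δ, fun x => lt_min (hε x) (hδ x),
        fun k hk => ⟨hs fun x => (hk x).trans_le (min_le_left _ _),
          ht fun x => (hk x).trans_le (min_le_right _ _)⟩⟩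
    | sUnion S _ ih =>
      rintro g ⟨s, hs, hgs⟩
      obtain ⟨ε, hε, h⟩ := ih s hs g hgs
      exact ⟨ε, hε, h.trans (subset_sUnion_of_mem hs)⟩
  refine ⟨fun s => ⟨fun hs => ?_, ?_⟩⟩
  · obtain ⟨U, hUs, hU, hf⟩ := mem_nhds_iff.1 hs
    obtain ⟨ε, hε, h⟩ := key U hU f hf
    exact ⟨ε, hε, h.trans hUs⟩
  · rintro ⟨ε, hε, h⟩
    refine mem_of_superset (IsOpen.mem_nhds (isOpen_generateFrom_of_mem ⟨f, ε, hε, rfl⟩) ?_) h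
    intro x
    simpa using hε x

end FineTopology

/-! ### Čech complete spaces -/

/-- A point of the Stone–Čech compactification having, for every `n`, a neighbourhood whose trace
on `Z` has diameter at most `1 / (n + 1)` is the limit of a Cauchy filter on `Z`. By completeness
such points lie in `Z`, so `Z` is the intersection of countably many open sets. -/
theorem isCechComplete_of_isCompletelyMetrizableSpace (Z : Type*) [TopologicalSpace Z]
    [IsCompletelyMetrizableSpace Z] : IsCechComplete Z := by
  let _ := upgradeIsCompletelyMetrizable Z
  refine ⟨StoneCech Z, inferInstance, inferInstance, inferInstance, stoneCechUnit,
    isEmbedding_stoneCechUnit, denseRange_stoneCechUnit, ?_⟩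
  let U : ℕ → Set (StoneCech Z) := fun n => ⋃₀ {V | IsOpen V ∧
    ∀ a b, stoneCechUnit a ∈ V → stoneCechUnit b ∈ V → dist a b < 1 / ((n : ℝ) + 1)}
  suffices h : range (stoneCechUnit : Z → StoneCech Z) = ⋂ n, U n by
    rw [h]
    exact .iInter_of_isOpen fun n => isOpen_sUnion fun V hV => hV.1
  refine Subset.antisymm ?_ fun y hy => ?_
  · rintro _ ⟨z, rfl⟩
    refine mem_iInter.2 fun n => ?_
    have hr : (0 : ℝ) < 1 / ((n : ℝ) + 1) / 2 := by positivity
    obtain ⟨V, hV, hzV⟩ :=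
      isEmbedding_stoneCechUnit.isInducing.isOpen_iff.1 (Metric.isOpen_ball (x := z)
        (ε := 1 / ((n : ℝ) + 1) / 2))
    refine ⟨V, ⟨hV, fun a b ha hb => ?_⟩, ?_⟩
    · have ha' : a ∈ Metric.ball z _ := hzV.subset ha
      have hb' : b ∈ Metric.ball z _ := hzV.subset hb
      have := dist_triangle_right a b z
      rw [Metric.mem_ball] at ha' hb'
      linarith
    · change z ∈ stoneCechUnit ⁻¹' V
      rw [hzV]
      exact Metric.mem_ball_self hr
  · have : (comap (stoneCechUnit : Z → StoneCech Z) (𝓝 y)).NeBot :=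
      isDenseEmbedding_stoneCechUnit.isDenseInducing.comap_nhds_neBot y
    have hc : Cauchy (comap (stoneCechUnit : Z → StoneCech Z) (𝓝 y)) := by
      refine Metric.cauchy_iff.2 ⟨this, fun ε hε => ?_⟩
      obtain ⟨n, hn⟩ := exists_nat_one_div_lt hε
      obtain ⟨V, ⟨hV, hd⟩, hyV⟩ := mem_iInter.1 hy n
      exact ⟨_, preimage_mem_comap (hV.mem_nhds hyV), fun a ha b hb => (hd a b ha hb).trans hn⟩
    obtain ⟨z, hz⟩ := CompleteSpace.complete hc
    refine ⟨z, tendsto_nhds_unique (f := stoneCechUnit) ?_ tendsto_comap⟩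
    exact (continuous_stoneCechUnit.tendsto z).mono_left hz

theorem IsCechComplete.isSieveComplete {Z : Type*} [TopologicalSpace Z] (h : IsCechComplete Z) :
    IsSieveComplete Z :=
  ⟨Z, inferInstance, id, h, continuous_id, IsOpenMap.id, Function.surjective_id⟩

/-- If `Z` is a `Gδ` set in a compact Hausdorff space `K`, then a closed `F ⊆ Z` is a `Gδ` set in
its closure in `K`, which is again compact Hausdorff. -/
theorem IsCechComplete.isHereditarilyBaire {Z : Type*} [TopologicalSpace Z]
    (h : IsCechComplete Z) : IsHereditarilyBaire Z := by
  obtain ⟨K, _, _, _, e, he, -, hG⟩ := h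
  intro F hF
  let C : Set K := closure (e '' F)
  have : CompactSpace C := isCompact_iff_compactSpace.1 isClosed_closure.isCompact
  let j : F → C := fun z => ⟨e z, subset_closure (mem_image_of_mem e z.2)⟩
  have hj : IsEmbedding j := (he.comp .subtypeVal).codRestrict C _
  have hr : range j = (↑) ⁻¹' range e := by
    ext ⟨y, hy⟩
    constructor
    · rintro ⟨z, hz⟩
      exact ⟨z, congrArg Subtype.val hz⟩
    · rintro ⟨z, rfl⟩
      have hz : z ∈ F := by
        rw [← hF.closure_eq, he.closure_eq_preimage_closure_image]
        exact hy
      exact ⟨⟨z, hz⟩, rfl⟩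
  have : BaireSpace (range j) := by
    rw [hr]
    exact (hG.preimage continuous_subtype_val).baireSpace_of_t2Space_locallyCompactSpace
  exact hj.toHomeomorph.symm.baireSpace

/-- A continuous open surjection `W → Z` restricts to a continuous open surjection from the closed
preimage of `F` onto `F`, and Baireness passes to the image of such a map. -/
theorem IsSieveComplete.isHereditarilyBaire {Z : Type*} [TopologicalSpace Z]
    (h : IsSieveComplete Z) : IsHereditarilyBaire Z := by
  obtain ⟨W, _, p, hW, hc, ho, hs⟩ := h
  intro F hF
  have : BaireSpace (p ⁻¹' F) := hW.isHereditarilyBaire _ (hF.preimage hc)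
  have hq : IsOpenQuotientMap (F.restrictPreimage p) :=
    ⟨hs.restrictPreimage F, hc.restrictPreimage, ho.restrictPreimage F⟩
  exact hq.baireSpace

/-! ### Spaces which are not pseudocompact -/

/-- On a space which is not pseudocompact there is a sequence on which continuous functions take
arbitrarily prescribed values. -/
theorem exists_interpolating_seq {X : Type*} [TopologicalSpace X] (h : ¬ IsPseudocompact X) :
    ∃ x : ℕ → X, ∀ b : ℕ → ℝ, ∃ g : C(X, ℝ), ∀ n, g (x n) = b n := by
  obtain ⟨φ, hφ⟩ : ∃ φ : C(X, ℝ), ∀ M : ℝ, ∃ x, M < |φ x| := by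
    simpa [IsPseudocompact] using h
  choose c hc using hφ
  -- The values of `|φ|` at the terms of the sequence grow by at least `1` at each step, so
  -- they form a closed discrete subset of `ℝ` to which Tietze's theorem applies.
  let x : ℕ → X := fun n => Nat.rec (c 0) (fun _ y => c (|φ y| + 1)) n
  have hstep : ∀ n, |φ (x n)| + 1 < |φ (x (n + 1))| := fun n => hc _
  have hgap : ∀ m n, m < n → |φ (x m)| + 1 ≤ |φ (x n)| := by
    intro m n hmn
    induction n, hmn using Nat.le_induction with
    | base => exact (hstep m).le
    | succ n _ ih => linarith [hstep n]
  have hemb : IsClosedEmbedding fun n => |φ (x n)| := by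
    refine Metric.isClosedEmbedding_of_pairwise_le_dist one_pos fun m n hmn => ?_
    change 1 ≤ dist |φ (x m)| |φ (x n)|
    rw [Real.dist_eq, le_abs]
    rcases lt_or_gt_of_ne hmn with h | h
    · right; linarith [hgap m n h]
    · left; linarith [hgap n m h]
  refine ⟨x, fun b => ?_⟩
  obtain ⟨g, hg⟩ := ContinuousMap.exists_extension hemb ⟨b, continuous_of_discreteTopology⟩
  exact ⟨⟨fun y => g |φ y|, by fun_prop⟩, fun n => congrArg (fun k : C(ℕ, ℝ) => k n) hg⟩

theorem exists_pos_interpolating {X : Type*} [TopologicalSpace X] {x : ℕ → X}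
    (hx : ∀ b : ℕ → ℝ, ∃ g : C(X, ℝ), ∀ n, g (x n) = b n) {b : ℕ → ℝ} (hb : ∀ n, 0 < b n) :
    ∃ ε : C(X, ℝ), (∀ y, 0 < ε y) ∧ ∀ n, ε (x n) = b n := by
  obtain ⟨g, hg⟩ := hx fun n => Real.log (b n)
  refine ⟨⟨fun y => Real.exp (g y), by fun_prop⟩, fun y => Real.exp_pos _, fun n => ?_⟩
  change Real.exp (g (x n)) = b n
  rw [hg, Real.exp_log (hb n)]

/-- Along an interpolating sequence `x`, the functions with `f (x n) = 0` for almost all `n` form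
a closed set: a function violating this is nonzero at infinitely many `x n`, and `ε` may be chosen
so small at these points that every function in the `ε`-ball is nonzero there too. It is
the union of the closed sets where `f (x m) = 0` for all `m ≥ n`, which have empty interior in it
because a small perturbation of the value at a single `x m` leaves them. Hence it is not Baire. -/
theorem IsHereditarilyBaire.isPseudocompact {X : Type*} [TopologicalSpace X]
    (h : IsHereditarilyBaire (FineC X ℝ)) : IsPseudocompact X := by
  by_contra hX
  obtain ⟨x, hx⟩ := exists_interpolating_seq hX
  let ev : ℕ → FineC X ℝ → ℝ := fun n f => (show C(X, ℝ) from f) (x n)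
  have hev : ∀ S : Set (FineC X ℝ), (∀ f g, (∀ n, ev n f ≠ 0 → ev n g ≠ 0) → g ∈ S → f ∈ S) →
      IsClosed S := by
    intro S hS
    refine isOpen_compl_iff.1 (isOpen_iff_mem_nhds.2 fun f hf => ?_)
    obtain ⟨ε, hε, hεx⟩ := exists_pos_interpolating hx
      (b := fun n => if ev n f = 0 then 1 else |ev n f|) fun n => by
        split_ifs with h0
        exacts [one_pos, abs_pos.2 h0]
    refine mem_of_superset ((FineC.nhds_hasBasis f).mem_of_mem hε) fun g hg hgS =>
      hf (hS f g (fun n hn hn' => ?_) hgS)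
    have h₁ : dist (ev n f) (ev n g) < ε (x n) := hg (x n)
    rw [hεx, if_neg hn, hn', Real.dist_eq, sub_zero] at h₁
    exact lt_irrefl _ h₁
  let F : Set (FineC X ℝ) := {f | ∃ n, ∀ m, n ≤ m → ev m f = 0}
  have hF : IsClosed F := hev F fun f g hfg ⟨n, hn⟩ =>
    ⟨n, fun m hm => by_contra fun h0 => hfg m h0 (hn m hm)⟩
  let A : ℕ → Set F := fun n => {f | ∀ m, n ≤ m → ev m f = 0}
  have hA : ∀ n, IsClosed (A n) := fun n =>
    (hev {f | ∀ m, n ≤ m → ev m f = 0} fun f g hfg hn m hm =>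
      by_contra fun h0 => hfg m h0 (hn m hm)).preimage continuous_subtype_val
  have hcover : ⋃ n, A n = univ := eq_univ_of_forall fun f => mem_iUnion.2 f.2
  have := h F hF
  have : Nonempty F := ⟨⟨(0 : C(X, ℝ)), 0, fun _ _ => rfl⟩⟩
  obtain ⟨n, f, hf⟩ := nonempty_interior_of_iUnion_of_closed hA hcover
  obtain ⟨ε, hε, hsub⟩ := ((FineC.nhds_hasBasis (f : FineC X ℝ)).comap ((↑) : F → FineC X ℝ)
    |>.mem_iff.1 (nhds_subtype F f ▸ mem_interior_iff_mem_nhds.1 hf))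
  -- `k` vanishes at all `x m` with `m ≠ n` but not at `x n`, and is truncated to stay below `ε`.
  obtain ⟨g, hg⟩ := hx (Pi.single n 1)
  let k : C(X, ℝ) := ⟨fun y => ε y / 2 * (|g y| / (1 + |g y|)), by
    have : ∀ y, 1 + |g y| ≠ 0 := fun y => by positivity
    fun_prop (disch := assumption)⟩
  have hk : ∀ y, |k y| < ε y := fun y => by
    have h₁ : |g y| / (1 + |g y|) ≤ 1 := div_le_one_of_le₀ (by linarith) (by positivity)
    have h₂ : 0 ≤ |g y| / (1 + |g y|) := by positivity
    change |ε y / 2 * (|g y| / (1 + |g y|))| < ε y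
    rw [abs_of_nonneg (mul_nonneg (half_pos (hε y)).le h₂)]
    nlinarith [hε y]
  let f' : C(X, ℝ) := f.1
  have hf'A : ∀ m, n ≤ m → f' (x m) = 0 := interior_subset hf
  have hsum : ∀ m, n < m → f' (x m) + k (x m) = 0 := fun m hm => by
    have : g (x m) = 0 := by rw [hg, Pi.single_eq_of_ne hm.ne']
    simp [k, this, hf'A m hm.le]
  have hmem : (f' + k : C(X, ℝ)) ∈ F := ⟨n + 1, fun m hm => hsum m hm⟩
  have hball : (f' + k : C(X, ℝ)) ∈ fineBall f' ε := fun y => by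
    simpa [Real.dist_eq] using hk y
  have h0 : f' (x n) + k (x n) = 0 := hsub (a := ⟨_, hmem⟩) hball n le_rfl
  have hgn : g (x n) = 1 := by rw [hg, Pi.single_eq_same]
  have : k (x n) = ε (x n) / 2 * (1 / 2) := by
    change ε (x n) / 2 * (|g (x n)| / (1 + |g (x n)|)) = _
    rw [hgn]; norm_num
  rw [hf'A n le_rfl, this] at h0
  linarith [hε (x n)]

/-! ### Pseudocompact spaces -/

theorem IsPseudocompact.exists_pos_le {X : Type*} [TopologicalSpace X] (h : IsPseudocompact X)
    {ε : C(X, ℝ)} (hε : ∀ x, 0 < ε x) : ∃ δ > 0, ∀ x, δ ≤ ε x := by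
  obtain ⟨M, hM⟩ := h ⟨fun x => (ε x)⁻¹, ε.continuous.inv₀ fun x => (hε x).ne'⟩
  refine ⟨(max M 1)⁻¹, by positivity, fun x => inv_le_of_inv_le₀ (hε x) ?_⟩
  exact ((le_abs_self _).trans (hM x)).trans (le_max_left _ _)

/-- On a pseudocompact space all continuous functions are bounded and all positive ones are bounded
away from zero, so `C_w(X)` is the Banach space of bounded continuous functions. -/
theorem IsPseudocompact.isCompletelyMetrizableSpace {X : Type*} [TopologicalSpace X]
    (h : IsPseudocompact X) : IsCompletelyMetrizableSpace (FineC X ℝ) := by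
  let T : BoundedContinuousFunction X ℝ ≃ FineC X ℝ :=
    { toFun := fun f => f.toContinuousMap
      invFun := fun f => .ofNormedAddCommGroup (show C(X, ℝ) from f)
        (ContinuousMap.continuous _) (h f).choose (h f).choose_spec
      left_inv := fun f => rfl
      right_inv := fun f => rfl }
  have hT : IsInducing T := by
    refine isInducing_iff_nhds.2 fun f =>
      Metric.nhds_basis_ball.ext ((FineC.nhds_hasBasis (T f)).comap T) ?_ ?_
    · intro r hr
      refine ⟨.const X (r / 2), fun _ => half_pos hr, fun g hg => ?_⟩
      rw [Metric.mem_ball, dist_comm]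
      refine lt_of_le_of_lt ((BoundedContinuousFunction.dist_le (half_pos hr).le).2 fun y => ?_)
        (half_lt_self hr)
      exact (hg y).le
    · intro ε hε
      obtain ⟨δ, hδ, hle⟩ := h.exists_pos_le hε
      refine ⟨δ, hδ, fun g hg y => ?_⟩
      rw [Metric.mem_ball, dist_comm] at hg
      exact ((BoundedContinuousFunction.dist_coe_le_dist y).trans_lt hg).trans_le (hle y)
  exact (T.toHomeomorphOfIsInducing hT).symm.isClosedEmbedding.IsCompletelyMetrizableSpace

theorem theorem2p2 (X : Type*) [TopologicalSpace X] [T35Space X] :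
    List.TFAE [
      TopologicalSpace.IsCompletelyMetrizableSpace (FineC X ℝ),
      IsCechComplete (FineC X ℝ),
      IsSieveComplete (FineC X ℝ),
      IsHereditarilyBaire (FineC X ℝ),
      IsPseudocompact X] := by
  tfae_have 1 → 2 := fun _ => isCechComplete_of_isCompletelyMetrizableSpace _
  tfae_have 2 → 3 := IsCechComplete.isSieveComplete
  tfae_have 3 → 4 := IsSieveComplete.isHereditarilyBaire
  tfae_have 4 → 5 := IsHereditarilyBaire.isPseudocompact
  tfae_have 5 → 1 := IsPseudocompact.isCompletelyMetrizableSpace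
  tfae_finish
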